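/- Fix $\lambda>0$, $\mu>0$ and $0<p\le 1$. A particle moves on $\mathbb{Z}$, starting at the origin at time $0$ with no broken bonds. It attempts to jump at the points of a Poisson process of rate $\lambda$, that is, the times between successive attempts are independent exponential random variables with rate $\lambda$. At an attempt, if both bonds adjacent to the particle are intact, it jumps over one of them, chosen with probability $1/2$ each; if exactly one of them is broken, it jumps over the other one; if both are broken, it stays where it is. Each time the particle jumps over a bond, that bond breaks with probability $p$, and a broken bond is repaired after an exponential time with rate $\mu$, after which it can be crossed again. All these random choices and times are independent. Let $X(t)$ be the position of the particle at time $t\ge 0$ (right-continuous). Then the process $\{X(t)\}_{t\ge 0}$ is recurrent: almost surely, for every $x\in\mathbb{Z}$, there are arbitrarily large times $t$ with $X(t)=x$. -/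

import Mathlib

open MeasureTheory ProbabilityTheory

namespace CollapsingBonds

noncomputable section

/-- The randomness attached to one attempt of the particle to jump:
`(wait, right, breaks, repair)`, where `wait` is the time elapsed since the previous attempt
(since time `0` for the first one), `right` is the direction that is chosen when both neighbouring
bonds are intact (`true` means right), `breaks` says whether the bond that is crossed at this
attempt breaks, and `repair` is the time its repair takes if it does. -/
abbrev Attempt : Type := ℝ × Bool × Bool × ℝ

namespace Attempt

def wait (a : Attempt) : ℝ := a.1
def right (a : Attempt) : Bool := a.2.1
def breaks (a : Attempt) : Bool := a.2.2.1
def repair (a : Attempt) : ℝ := a.2.2.2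

/-- The number `1 / 2` as a probability. -/
def fairCoin : unitInterval := ⟨1 / 2, by norm_num, by norm_num⟩

/-- The law of one attempt: the four components are independent, `wait` is exponential with rate
`lam`, `right` is a fair coin, `breaks` is `true` with probability `p`, and `repair` is exponential
with rate `mu`. -/
def law (lam mu : ℝ) (p : unitInterval) : Measure Attempt :=
  (expMeasure lam).prod
    ((bernoulliMeasure true false fairCoin).prod
      ((bernoulliMeasure true false p).prod (expMeasure mu)))

end Attempt

/-- The situation right after an attempt (or at the start): the current `time`, the position `pos`
of the particle, and for each bond the time at which it is repaired after its last break
(`0` if it never broke). The bond joining `e` and `e + 1` carries the label `e`. -/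
structure State where
  time : ℝ
  pos : ℤ
  repairedAt : ℤ → ℝ

/-- At time `0` the particle is at the origin and no bond is broken. -/
def State.init : State where
  time := 0
  pos := 0
  repairedAt := fun _ => 0

/-- The displacement of a particle that attempts to jump, given whether the bond on its left and
the bond on its right are broken, and the direction it chooses when both are intact. -/
def displacement (leftBroken rightBroken right : Prop) [Decidable leftBroken]
    [Decidable rightBroken] [Decidable right] : ℤ :=
  if leftBroken ∧ rightBroken then 0
  else if leftBroken then 1
  else if rightBroken then -1
  else if right then 1
  else -1

/-- The effect of the next attempt. A bond is broken at time `t` iff `t < repairedAt e`. -/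
def State.next (s : State) (a : Attempt) : State :=
  let t := s.time + a.wait
  let d := displacement (t < s.repairedAt (s.pos - 1)) (t < s.repairedAt s.pos) (a.right = true)
  -- the bond between `s.pos` and `s.pos + d` (only relevant if `d ≠ 0`)
  let crossed := if d = 1 then s.pos else s.pos - 1
  { time := t
    pos := s.pos + d
    repairedAt :=
      if d ≠ 0 ∧ a.breaks = true then Function.update s.repairedAt crossed (t + a.repair)
      else s.repairedAt }

/-- The situation right after the first `n` attempts. -/
def stateAfter (a : ℕ → Attempt) : ℕ → State
  | 0 => State.init
  | n + 1 => (stateAfter a n).next (a n)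

/-- The number of attempts that are made up to and including time `t`. -/
def attemptsUpTo (a : ℕ → Attempt) (t : ℝ) : ℕ :=
  {n : ℕ | (stateAfter a (n + 1)).time ≤ t}.ncard

/-- The position of the particle at time `t`. -/
def position (a : ℕ → Attempt) (t : ℝ) : ℤ :=
  (stateAfter a (attemptsUpTo a t)).pos

/-- An integer-valued process in continuous time is recurrent if almost surely it visits every
integer at arbitrarily large times. -/
def IsRecurrent {Ω : Type*} [MeasurableSpace Ω] (X : ℝ → Ω → ℤ) (P : Measure Ω) : Prop :=
  ∀ᵐ ω ∂P, ∀ x : ℤ, ∀ s : ℝ, ∃ t : ℝ, s ≤ t ∧ X t ω = x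

end

end CollapsingBonds

/-! The broken bonds give the walk a memory, and the proof finds times at which it is erased. The
chain `backlog` dominates every remaining repair time. Its exponential moments contract up to a
constant, so it is below some fixed `K` infinitely often (`exists_frequently_backlog_le`). If the
next wait exceeds `K`, all bonds are intact at the next jump and the walk restarts as a translated
fresh copy (`pos_add_of_backlog_le`). By Lévy's zero-one law, an event forced by a fresh copy lying
in a set of positive measure is then almost sure (`ae_mem_of_restart`).

Applied to long runs of right moves, this gives arbitrarily large displacements, so the walk is
unbounded above or below. By reflection symmetry, `Above` has positive probability together with a
long first wait; since `Above` survives translation, a restart makes it almost sure, and reflection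
gives `Below`. Steps of size at most one then force infinitely many visits to every integer, at
times tending to infinity. -/

namespace CollapsingBonds

/-! ### Backlog and restarts, for a fixed sequence -/

/-- An upper bound for the remaining repair times just after the `n`-th attempt: every attempt
schedules a repair, whether or not a bond breaks. -/
noncomputable def backlog (a : ℕ → Attempt) : ℕ → ℝ
  | 0 => 0
  | n + 1 => max (backlog a n - (a n).wait) (a n).repair

/-- In absolute time the backlog is a deadline: one step replaces `time + backlog` by its maximum
with the newly scheduled repair time. -/
lemma repairedAt_le_backlog (a : ℕ → Attempt) (n : ℕ) (e : ℤ) :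
    (stateAfter a n).repairedAt e ≤ (stateAfter a n).time + backlog a n := by
  induction n generalizing e with
  | zero => simp [stateAfter, State.init, backlog]
  | succ n ih =>
    have h := ih e
    simp only [stateAfter, State.next, backlog]
    split_ifs
    all_goals first
      | (rcases eq_or_ne e (stateAfter a n).pos with he | he <;>
          rcases eq_or_ne e ((stateAfter a n).pos - 1) with he' | he' <;>
          simp only [he, he', Function.update_apply] <;> grind)
      | grind

/-- Two states look alike, up to a translation by `k`, once the time `w` has elapsed. -/
def Agree (w : ℝ) (k : ℤ) (s s' : State) : Prop :=
  s.pos = s'.pos + k ∧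
    ∀ e, max (s.repairedAt (e + k) - s.time) w = max (s'.repairedAt e - s'.time) w

lemma Agree.mono {w w' : ℝ} (hw : w ≤ w') {k : ℤ} {s s' : State} (h : Agree w k s s') :
    Agree w' k s s' := by
  refine ⟨h.1, fun e => ?_⟩
  have := h.2 e
  grind

/-- Truncation at `a.wait` hides only repairs completed by the jump time. Corresponding bonds are
therefore broken in both states or in neither, the same move follows, and the threshold drops to `0`
once the wait has elapsed. -/
lemma Agree.next {k : ℤ} {s s' : State} {a : Attempt} (h : Agree a.wait k s s') :
    Agree 0 k (s.next a) (s'.next a) := by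
  obtain ⟨hp, hr⟩ := h
  have hb : ∀ e, (s.time + a.wait < s.repairedAt (e + k)) ↔ (s'.time + a.wait < s'.repairedAt e) := by
    intro e
    have := hr e
    grind
  have h1 : (s.time + a.wait < s.repairedAt (s.pos - 1)) ↔
      (s'.time + a.wait < s'.repairedAt (s'.pos - 1)) := by
    rw [← hb, hp]; ring_nf
  have h2 : (s.time + a.wait < s.repairedAt s.pos) ↔
      (s'.time + a.wait < s'.repairedAt s'.pos) := by
    rw [← hb, hp]
  have hd : displacement (s.time + a.wait < s.repairedAt (s.pos - 1))
      (s.time + a.wait < s.repairedAt s.pos) (a.right = true) =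
      displacement (s'.time + a.wait < s'.repairedAt (s'.pos - 1))
      (s'.time + a.wait < s'.repairedAt s'.pos) (a.right = true) := by
    simp only [displacement, h1, h2]
  refine ⟨?_, fun e => ?_⟩
  · simp only [State.next]
    rw [hd, hp]; ring
  · have := hr e
    simp only [State.next, hd]
    generalize displacement (s'.time + a.wait < s'.repairedAt (s'.pos - 1))
      (s'.time + a.wait < s'.repairedAt s'.pos) (a.right = true) = d
    by_cases hc : d ≠ 0 ∧ a.breaks = true
    · simp only [if_pos hc, Function.update_apply]
      have he : (e + k = if d = 1 then s.pos else s.pos - 1) ↔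
          (e = if d = 1 then s'.pos else s'.pos - 1) := by
        rw [hp]; split_ifs <;> omega
      simp only [he]
      split_ifs <;> grind
    · simp only [if_neg hc]
      grind

/-- If every bond is repaired before the `n`-th attempt, the walk starts afresh. -/
lemma pos_add_of_backlog_le (a : ℕ → Attempt) (ha : ∀ n, 0 ≤ (a n).wait) (n : ℕ)
    (hn : backlog a n ≤ (a n).wait) (k : ℕ) :
    (stateAfter a (n + k)).pos =
      (stateAfter (fun i => a (n + i)) k).pos + (stateAfter a n).pos := by
  have h0 : Agree (a n).wait (stateAfter a n).pos (stateAfter a n) State.init := by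
    refine ⟨by simp [State.init], fun e => ?_⟩
    have := repairedAt_le_backlog a n (e + (stateAfter a n).pos)
    have := ha n
    simp only [State.init]
    grind
  have h : ∀ k, Agree (a (n + k)).wait (stateAfter a n).pos (stateAfter a (n + k))
      (stateAfter (fun i => a (n + i)) k) := by
    intro k
    induction k with
    | zero => exact h0
    | succ k ih => exact (Agree.next ih).mono (ha _)
  exact (h k).1

lemma abs_pos_succ_sub_le (a : ℕ → Attempt) (n : ℕ) :
    |(stateAfter a (n + 1)).pos - (stateAfter a n).pos| ≤ 1 := by
  simp only [stateAfter, State.next, displacement]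
  split_ifs <;> simp

/-- The bonds ahead of the particle have never been crossed, hence are intact; a broken bond behind
only forces the same move to the right. -/
lemma pos_of_forall_right (a : ℕ → Attempt) (M : ℕ)
    (h : ∀ i < M, 0 ≤ (a i).wait ∧ (a i).right = true) :
    (stateAfter a M).pos = M := by
  suffices H : ∀ k ≤ M, (stateAfter a k).pos = k ∧ 0 ≤ (stateAfter a k).time ∧
      ∀ e : ℤ, k ≤ e → (stateAfter a k).repairedAt e = 0 from (H M le_rfl).1
  intro k hk
  induction k with
  | zero => simp [stateAfter, State.init]
  | succ k ih =>
    obtain ⟨hp, ht, hr⟩ := ih (by omega)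
    obtain ⟨hw, hR⟩ := h k (by omega)
    have hd : displacement ((stateAfter a k).time + (a k).wait <
        (stateAfter a k).repairedAt ((stateAfter a k).pos - 1))
        ((stateAfter a k).time + (a k).wait < (stateAfter a k).repairedAt (stateAfter a k).pos)
        ((a k).right = true) = 1 := by
      have : ¬ ((stateAfter a k).time + (a k).wait <
          (stateAfter a k).repairedAt (stateAfter a k).pos) := by
        rw [hp, hr _ le_rfl]; linarith
      simp [displacement, this, hR]
    refine ⟨?_, ?_, fun e he => ?_⟩
    · simp only [stateAfter, State.next]
      rw [hd, hp]; push_cast; ring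
    · simp only [stateAfter, State.next]; linarith
    · push_cast at he
      simp only [stateAfter, State.next]
      rw [hd, if_pos rfl, hp]
      split_ifs
      · rw [Function.update_of_ne (by omega)]; exact hr e (by omega)
      · exact hr e (by omega)

/-! ### Reflection symmetry -/

/-- The attempt with the opposite direction. -/
def Attempt.reflect (a : Attempt) : Attempt := (a.wait, !a.right, a.breaks, a.repair)

/-- Under `x ↦ -x` the bond from `e` to `e + 1` becomes the one from `-1 - e` to `-e`, whence the
label `-1 - e`. -/
lemma stateAfter_reflect (a : ℕ → Attempt) (n : ℕ) :
    (stateAfter (fun i => (a i).reflect) n).time = (stateAfter a n).time ∧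
    (stateAfter (fun i => (a i).reflect) n).pos = -(stateAfter a n).pos ∧
    ∀ e, (stateAfter (fun i => (a i).reflect) n).repairedAt e =
      (stateAfter a n).repairedAt (-1 - e) := by
  induction n with
  | zero => simp [stateAfter, State.init]
  | succ n ih =>
    obtain ⟨ht, hp, hr⟩ := ih
    simp only [stateAfter, State.next]
    generalize stateAfter (fun i => (a i).reflect) n = s' at *
    generalize stateAfter a n = s at *
    have e1 : -1 - (-s.pos - 1) = s.pos := by ring
    have e2 : -1 - (-s.pos) = s.pos - 1 := by ring
    have hw : (a n).reflect.wait = (a n).wait := rfl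
    have hb : (a n).reflect.breaks = (a n).breaks := rfl
    have hrep : (a n).reflect.repair = (a n).repair := rfl
    have hR : (a n).reflect.right = !(a n).right := rfl
    have hd : displacement (s'.time + (a n).reflect.wait < s'.repairedAt (s'.pos - 1))
      (s'.time + (a n).reflect.wait < s'.repairedAt s'.pos) ((a n).reflect.right = true) =
      - displacement (s.time + (a n).wait < s.repairedAt (s.pos - 1))
      (s.time + (a n).wait < s.repairedAt s.pos) ((a n).right = true) := by
      rw [hr, hr, hp, e1, e2, hw, ht, hR]
      simp only [displacement]
      cases (a n).right <;> grind
    have hd3 : ∀ x y z : Prop, [Decidable x] → [Decidable y] → [Decidable z] →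
        displacement x y z = 0 ∨ displacement x y z = 1 ∨ displacement x y z = -1 := by
      intro x y z _ _ _
      simp only [displacement]
      split_ifs <;> simp
    rw [hd]
    have := hd3 (s.time + (a n).wait < s.repairedAt (s.pos - 1))
      (s.time + (a n).wait < s.repairedAt s.pos) ((a n).right = true)
    generalize displacement (s.time + (a n).wait < s.repairedAt (s.pos - 1))
      (s.time + (a n).wait < s.repairedAt s.pos) ((a n).right = true) = d at *
    refine ⟨by rw [ht, hw], by rw [hp]; ring, fun e => ?_⟩
    have c : (-d ≠ 0 ∧ (a n).reflect.breaks = true) ↔ (d ≠ 0 ∧ (a n).breaks = true) := by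
      rw [hb, neg_ne_zero]
    simp only [c]
    split_ifs with h1 h2 h3 h3
    · omega
    · simp only [Function.update_apply, hr, ht, hw, hrep, hp]
      congr 1
      simp only [eq_iff_iff]; omega
    · simp only [Function.update_apply, hr, ht, hw, hrep, hp]
      congr 1
      simp only [eq_iff_iff]; omega
    · omega
    · exact hr e

/-! ### From unboundedness to recurrence -/

/-- An integer sequence with steps at most `1` that is unbounded in both directions takes each
value infinitely often. -/
lemma exists_ge_eq_of_unbounded {X : ℕ → ℤ} (hstep : ∀ n, |X (n + 1) - X n| ≤ 1)
    (habove : ∀ M : ℕ, ∃ n, (M : ℤ) ≤ X n) (hbelow : ∀ M : ℕ, ∃ n, X n ≤ -(M : ℤ))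
    (x : ℤ) (N : ℕ) : ∃ n, N ≤ n ∧ X n = x := by
  have hbd : ∀ n, |X n - X 0| ≤ n := by
    intro n
    induction n with
    | zero => simp
    | succ n ih =>
      have := hstep n
      rw [abs_le] at *
      push_cast
      omega
  have ivt : ∀ m k, X m ≤ x → x ≤ X (m + k) → ∃ n, m ≤ n ∧ X n = x := by
    intro m k h1 h2
    induction k with
    | zero => exact ⟨m, le_rfl, le_antisymm h1 h2⟩
    | succ k ih =>
      by_cases h : x ≤ X (m + k)
      · exact ih h
      · have := hstep (m + k)
        rw [abs_le] at this
        exact ⟨m + (k + 1), by omega, by rw [← add_assoc] at h2 ⊢; omega⟩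
  -- By `hbd`, a level this far from `X 0` cannot be reached in fewer than `B` steps.
  have far : ∀ B : ℕ, ∃ n, B ≤ n ∧ x ≤ X n := by
    intro B
    obtain ⟨n, hn⟩ := habove (B + (X 0).natAbs + x.natAbs)
    have := hbd n
    rw [abs_le] at this
    exact ⟨n, by omega, by omega⟩
  obtain ⟨m, hm⟩ := hbelow (N + (X 0).natAbs + x.natAbs)
  have h1 := hbd m
  rw [abs_le] at h1
  obtain ⟨n, hn, hx⟩ := far m
  obtain ⟨j, hj, hj'⟩ := ivt m (n - m) (by omega) (by rwa [Nat.add_sub_cancel' hn])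
  exact ⟨j, by omega, hj'⟩

lemma time_lt_time_succ {a : ℕ → Attempt} (ha : ∀ n, 0 < (a n).wait) (n : ℕ) :
    (stateAfter a n).time < (stateAfter a (n + 1)).time := by
  simp only [stateAfter, State.next]
  linarith [ha n]

/-- With increasing times, `attemptsUpTo` counts exactly the `k` with `k + 1 ≤ n`, which are `n`
many. -/
lemma position_time {a : ℕ → Attempt} (ha : ∀ n, 0 < (a n).wait) (n : ℕ) :
    position a (stateAfter a n).time = (stateAfter a n).pos := by
  have hmono : StrictMono fun n => (stateAfter a n).time :=
    strictMono_nat_of_lt_succ (time_lt_time_succ ha)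
  have : attemptsUpTo a (stateAfter a n).time = n := by
    have h : {k : ℕ | (stateAfter a (k + 1)).time ≤ (stateAfter a n).time} = Finset.range n := by
      ext k
      simp only [Set.mem_ofPred_eq, Finset.coe_range, Set.mem_Iio]
      rw [hmono.le_iff_le]; omega
    rw [attemptsUpTo, h, Set.ncard_coe_finset, Finset.card_range]
  rw [position, this]

/-- Infinitely many waits of length at least one rule out explosion. -/
lemma exists_time_ge {a : ℕ → Attempt} (ha : ∀ n, 0 < (a n).wait)
    (hinf : ∀ m, ∃ n, m ≤ n ∧ 1 ≤ (a n).wait) (s : ℝ) :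
    ∃ n, ∀ k, n ≤ k → s ≤ (stateAfter a k).time := by
  have hmono : StrictMono fun n => (stateAfter a n).time :=
    strictMono_nat_of_lt_succ (time_lt_time_succ ha)
  have h : ∀ M : ℕ, ∃ n, (M : ℝ) ≤ (stateAfter a n).time := by
    intro M
    induction M with
    | zero => exact ⟨0, by simp [stateAfter, State.init]⟩
    | succ M ih =>
      obtain ⟨m, hm⟩ := ih
      obtain ⟨n, hn, hw⟩ := hinf m
      refine ⟨n + 1, ?_⟩
      have := hmono.monotone hn
      simp only [stateAfter, State.next] at this ⊢
      push_cast
      linarith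
  obtain ⟨M, hM⟩ := exists_nat_ge s
  obtain ⟨n, hn⟩ := h M
  exact ⟨n, fun k hk => hM.trans (hn.trans (hmono.monotone hk))⟩

lemma exists_time_position_eq {a : ℕ → Attempt} (ha : ∀ n, 0 < (a n).wait)
    (hinf : ∀ m, ∃ n, m ≤ n ∧ 1 ≤ (a n).wait)
    (habove : ∀ M : ℕ, ∃ n, (M : ℤ) ≤ (stateAfter a n).pos)
    (hbelow : ∀ M : ℕ, ∃ n, (stateAfter a n).pos ≤ -(M : ℤ)) (x : ℤ) (s : ℝ) :
    ∃ t, s ≤ t ∧ position a t = x := by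
  obtain ⟨N, hN⟩ := exists_time_ge ha hinf s
  obtain ⟨n, hn, hx⟩ := exists_ge_eq_of_unbounded (abs_pos_succ_sub_le a) habove hbelow x N
  exact ⟨_, hN n hn, (position_time ha n).trans hx⟩

/-! ### Independent sequences and a conditional zero-one law -/

open Filter

section IID

variable {S : Type*} [MeasurableSpace S]

/-- The information carried by the first `n` terms of a sequence. -/
def past (S : Type*) [MeasurableSpace S] :
    Filtration ℕ (MeasurableSpace.pi : MeasurableSpace (ℕ → S)) where
  seq n := ⨆ i ∈ Set.Iio n, MeasurableSpace.comap (fun ω : ℕ → S => ω i) inferInstance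
  mono' _ _ h := biSup_mono fun _ hi => lt_of_lt_of_le hi h
  le' _ := iSup₂_le fun i _ => (measurable_pi_apply i).comap_le

lemma measurable_past_eval {i n : ℕ} (h : i < n) :
    Measurable[past S n] (fun ω : ℕ → S => ω i) := by
  apply Measurable.of_comap_le
  exact le_iSup₂_of_le (f := fun i (_ : i ∈ Set.Iio n) =>
    MeasurableSpace.comap (fun ω : ℕ → S => ω i) inferInstance) i h le_rfl

lemma iSup_past : ⨆ n, past S n = (MeasurableSpace.pi : MeasurableSpace (ℕ → S)) := by
  refine le_antisymm (iSup_le fun n => (past S).le n) ?_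
  refine iSup_le fun i => ?_
  exact le_iSup_of_le (f := fun n => past S n) (i + 1)
    (measurable_past_eval (Nat.lt_succ_self i)).comap_le

/-- The information carried by the terms of a sequence from the `n`-th one on. -/
@[reducible]
def future (S : Type*) [MeasurableSpace S] (n : ℕ) : MeasurableSpace (ℕ → S) :=
  ⨆ i ∈ Set.Ici n, MeasurableSpace.comap (fun ω : ℕ → S => ω i) inferInstance

lemma future_le (n : ℕ) : future S n ≤ MeasurableSpace.pi :=
  iSup₂_le fun i _ => (measurable_pi_apply i).comap_le

lemma measurable_future_eval {i n : ℕ} (h : n ≤ i) :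
    Measurable[future S n] (fun ω : ℕ → S => ω i) := by
  apply Measurable.of_comap_le
  exact le_iSup₂_of_le (f := fun i (_ : i ∈ Set.Ici n) =>
    MeasurableSpace.comap (fun ω : ℕ → S => ω i) inferInstance) i h le_rfl

variable (ν : Measure S) [IsProbabilityMeasure ν]

/-- The law of a sequence of independent random variables with law `ν`. -/
noncomputable abbrev iidLaw : Measure (ℕ → S) := Measure.infinitePi fun _ : ℕ => ν

lemma indep_past_future (n : ℕ) : Indep (past S n) (future S n) (iidLaw ν) := by
  have h : iIndepFun (fun (i : ℕ) (ω : ℕ → S) => ω i) (iidLaw ν) :=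
    iIndepFun_infinitePi (X := fun _ x => x) (fun _ => measurable_id)
  refine indep_iSup_of_disjoint (fun i => (measurable_pi_apply i).comap_le)
    ((iIndepFun_iff_iIndep ..).1 h) ?_
  rw [Set.disjoint_left]
  intro i hi hi'
  exact absurd (Set.mem_Ici.1 hi') (not_le.2 (Set.mem_Iio.1 hi))

/-- The shifted sequence depends only on the future, hence is independent of `G`, and it has the law
of the original sequence. -/
lemma measure_inter_shift {n : ℕ} {G A : Set (ℕ → S)} (hG : MeasurableSet[past S n] G)
    (hA : MeasurableSet A) :
    iidLaw ν (G ∩ {ω | (fun i => ω (n + i)) ∈ A}) = iidLaw ν G * iidLaw ν A := by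
  have hm : Measurable[future S n] (fun (ω : ℕ → S) i => ω (n + i)) :=
    @measurable_pi_lambda _ _ _ (future S n) _ _
      fun i => measurable_future_eval (Nat.le_add_right n i)
  have h := (Indep_iff _ _ _).1 (indep_past_future ν n) G _ hG (hm hA)
  have hmap : (iidLaw ν).map (fun (ω : ℕ → S) i => ω (n + i)) = iidLaw ν :=
    Measure.map_infinitePi_infinitePi_of_inj (P := fun _ : ℕ => ν) (add_right_injective n)
  have h2 := Measure.map_apply (hm.mono (future_le n) le_rfl) hA (μ := iidLaw ν)
  rw [hmap] at h2
  rw [h2]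
  exact h

lemma lintegral_mul_eval {n : ℕ} {f : (ℕ → S) → ENNReal} (hf : Measurable[past S n] f)
    {g : S → ENNReal} (hg : Measurable g) :
    ∫⁻ ω, f ω * g (ω n) ∂(iidLaw ν) = (∫⁻ ω, f ω ∂(iidLaw ν)) * ∫⁻ x, g x ∂ν := by
  have h := lintegral_mul_eq_lintegral_mul_lintegral_of_independent_measurableSpace ((past S).le n)
    (future_le n) (indep_past_future ν n) hf (hg.comp (measurable_future_eval le_rfl))
  refine h.trans ?_
  congr 1
  exact (measurePreserving_eval_infinitePi (fun _ : ℕ => ν) n).lintegral_comp hg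

/-- A conditional zero-one law: if the conditional probability of `E` given the past is bounded
below at infinitely many times, then `E` is almost sure. -/
lemma ae_mem_of_frequently_le {Ω : Type*} {m0 : MeasurableSpace Ω} (μ : Measure Ω)
    [IsProbabilityMeasure μ] (ℱ : Filtration ℕ m0) (hℱ : ⨆ n, ℱ n = m0) {E : Set Ω}
    (hE : MeasurableSet E) {B : ℕ → Set Ω} (hB : ∀ n, MeasurableSet[ℱ n] (B n))
    (hio : ∀ᵐ ω ∂μ, ∃ᶠ n in atTop, ω ∈ B n) {c : ℝ} (hc : 0 < c)
    (h : ∀ n G, MeasurableSet[ℱ n] G → G ⊆ B n → c * μ.real G ≤ μ.real (G ∩ E)) :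
    ∀ᵐ ω ∂μ, ω ∈ E := by
  set g : Ω → ℝ := E.indicator fun _ => 1 with hg
  have hgi : Integrable g μ := (integrable_const (1 : ℝ)).indicator hE
  have hge : μ[g | ⨆ n, ℱ n] = g := by
    apply condExp_of_stronglyMeasurable (hℱ.le) _ hgi
    rw [hℱ]
    exact stronglyMeasurable_const.indicator hE
  -- Lévy's upward theorem: the conditional probabilities of `E` converge to its indicator, so being
  -- at least `c` infinitely often excludes the limit `0`.
  have hlim := tendsto_ae_condExp (μ := μ) (ℱ := ℱ) g
  rw [hge] at hlim
  have hlow : ∀ n, ∀ᵐ ω ∂μ, ω ∈ B n → c ≤ (μ[g | ℱ n]) ω := by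
    intro n
    -- If this exceptional set had positive measure, integrating over it would contradict `h`.
    set G : Set Ω := B n ∩ {ω | (μ[g | ℱ n]) ω < c} with hGdef
    have hGm : MeasurableSet[ℱ n] G :=
      (hB n).inter (@measurableSet_lt _ _ _ _ _ (ℱ n) _ _ _ _ _
        stronglyMeasurable_condExp.measurable measurable_const)
    have hG0 : μ G = 0 := by
      by_contra hne
      have h1 := h n G hGm Set.inter_subset_left
      have hi : Integrable (μ[g | ℱ n]) μ := integrable_condExp
      have h2 : ∫ ω in G, (μ[g | ℱ n]) ω ∂μ = μ.real (G ∩ E) := by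
        rw [setIntegral_condExp (ℱ.le n) hgi hGm, hg, integral_indicator hE,
          Measure.restrict_restrict hE, integral_const]
        simp [Set.inter_comm]
      have h3 : ∫ ω in G, (c - (μ[g | ℱ n]) ω) ∂μ = c * μ.real G - μ.real (G ∩ E) := by
        rw [integral_sub (integrable_const _) hi.integrableOn, h2]
        simp [mul_comm]
      have hGm' := ℱ.le n _ hGm
      have h4 : 0 < ∫ ω in G, (c - (μ[g | ℱ n]) ω) ∂μ := by
        rw [setIntegral_pos_iff_support_of_nonneg_ae]
        · refine lt_of_lt_of_le (pos_iff_ne_zero.2 hne) (measure_mono fun ω hω => ⟨?_, hω⟩)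
          have := hω.2
          simp only [Set.mem_ofPred_eq] at this
          simp only [Function.mem_support]
          linarith
        · filter_upwards [ae_restrict_mem hGm'] with ω hω
          have := hω.2
          simp only [Set.mem_ofPred_eq] at this
          simp only [Pi.zero_apply]
          linarith
        · exact ((integrable_const _).sub hi).integrableOn
      linarith
    filter_upwards [measure_eq_zero_iff_ae_notMem.1 hG0] with ω hω hωB
    by_contra hlt
    exact hω ⟨hωB, not_le.1 hlt⟩
  filter_upwards [hlim, hio, ae_all_iff.2 hlow] with ω h1 h2 h3
  by_contra hω
  have h4 : g ω = 0 := Set.indicator_of_notMem hω _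
  rw [h4] at h1
  obtain ⟨n, hn, hn'⟩ := (h2.and_eventually (h1.eventually (gt_mem_nhds hc))).exists
  exact absurd (h3 n hn) (not_le.2 hn')

end IID


/-! ### The law of a single jump attempt -/

lemma expMeasure_pos_of_lt {r : ℝ} (hr : 0 < r) (K : ℝ) : 0 < expMeasure r (Set.Ioi K) := by
  have := isProbabilityMeasure_expMeasure hr
  have h : cdf (expMeasure r) K < 1 := by
    rw [cdf_expMeasure_eq hr]
    split_ifs
    · linarith [Real.exp_pos (-(r * K))]
    · exact one_pos
  rw [cdf_eq_real] at h
  have h2 := measureReal_add_measureReal_compl (μ := expMeasure r) (measurableSet_Iic (a := K))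
  rw [Set.compl_Iic] at h2
  have h3 : 0 < (expMeasure r).real (Set.Ioi K) := by
    simp at h2; linarith
  exact (ENNReal.toReal_pos_iff.1 h3).1

lemma ae_expMeasure_pos {r : ℝ} (hr : 0 < r) : ∀ᵐ x ∂(expMeasure r), 0 < x := by
  have := isProbabilityMeasure_expMeasure hr
  have h : cdf (expMeasure r) 0 = 0 := by
    rw [cdf_expMeasure_eq hr]; simp
  rw [cdf_eq_real, measureReal_eq_zero_iff] at h
  rw [ae_iff]
  convert h using 2
  ext x; simp

/-- The exponential moments of an exponential law. -/
lemma lintegral_exp_expMeasure {r s : ℝ} (hr : 0 < r) (hs : s < r) :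
    ∫⁻ x, ENNReal.ofReal (Real.exp (s * x)) ∂(expMeasure r) = ENNReal.ofReal (r / (r - s)) := by
  have h : expMeasure r = volume.withDensity (exponentialPDF r) := rfl
  have hm : ∀ r, Measurable (exponentialPDF r) := fun r =>
    (measurable_exponentialPDFReal r).ennreal_ofReal
  rw [h, lintegral_withDensity_eq_lintegral_mul _ (hm r) (by fun_prop)]
  have hrs : 0 < r - s := by linarith
  -- Exponential tilting turns the density of rate `r` into a multiple of the density of rate `r -
  -- s`.
  have h2 : (exponentialPDF r * fun x => ENNReal.ofReal (Real.exp (s * x))) =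
      fun x => ENNReal.ofReal (r / (r - s)) * exponentialPDF (r - s) x := by
    ext x
    simp only [Pi.mul_apply, exponentialPDF_eq]
    rw [← ENNReal.ofReal_mul' (Real.exp_pos _).le, ← ENNReal.ofReal_mul (by positivity)]
    congr 1
    split_ifs
    · rw [mul_assoc, ← Real.exp_add]
      field_simp
      congr 1; ring
    · simp
  rw [h2, lintegral_const_mul _ (hm _), lintegral_exponentialPDF_eq_one hrs, mul_one]

namespace Attempt

lemma measurable_wait : Measurable wait := measurable_fst
lemma measurable_right : Measurable right := measurable_fst.comp measurable_snd
lemma measurable_breaks : Measurable breaks :=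
  measurable_fst.comp (measurable_snd.comp measurable_snd)
lemma measurable_repair : Measurable repair :=
  measurable_snd.comp (measurable_snd.comp measurable_snd)

variable {lam mu : ℝ} {p : unitInterval}

lemma isProbabilityMeasure_law (hlam : 0 < lam) (hmu : 0 < mu) :
    IsProbabilityMeasure (law lam mu p) := by
  have := isProbabilityMeasure_expMeasure hlam
  have := isProbabilityMeasure_expMeasure hmu
  unfold law
  infer_instance

lemma measurePreserving_wait (hlam : 0 < lam) (hmu : 0 < mu) :
    MeasurePreserving wait (law lam mu p) (expMeasure lam) := by
  have := isProbabilityMeasure_expMeasure hlam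
  have := isProbabilityMeasure_expMeasure hmu
  exact measurePreserving_fst

lemma measurePreserving_repair (hlam : 0 < lam) (hmu : 0 < mu) :
    MeasurePreserving repair (law lam mu p) (expMeasure mu) := by
  have := isProbabilityMeasure_expMeasure hlam
  have := isProbabilityMeasure_expMeasure hmu
  exact measurePreserving_snd.comp (measurePreserving_snd.comp measurePreserving_snd)

lemma measurable_reflect : Measurable reflect :=
  measurable_wait.prodMk (((measurable_of_finite not).comp measurable_right).prodMk
    (measurable_breaks.prodMk measurable_repair))

lemma map_not_fairCoin :
    (bernoulliMeasure true false fairCoin).map not = bernoulliMeasure true false fairCoin := by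
  have hs : unitInterval.symm fairCoin = fairCoin := by
    apply Subtype.ext; simp [fairCoin]; norm_num
  ext s hs'
  classical
  rw [Measure.map_apply (measurable_of_finite _) hs', bernoulliMeasure_apply _ hs',
    bernoulliMeasure_apply _ (measurable_of_finite not hs'), hs]
  simp only [Set.mem_preimage, Bool.not_true, Bool.not_false]
  split_ifs <;> rfl

lemma measurePreserving_reflect (hlam : 0 < lam) (hmu : 0 < mu) :
    MeasurePreserving reflect (law lam mu p) (law lam mu p) := by
  have := isProbabilityMeasure_expMeasure hlam
  have := isProbabilityMeasure_expMeasure hmu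
  exact (MeasurePreserving.id _).prod
    (MeasurePreserving.prod ⟨measurable_of_finite _, map_not_fairCoin⟩ (MeasurePreserving.id _))

lemma law_pos (hlam : 0 < lam) (hmu : 0 < mu) (K : ℝ) :
    0 < law lam mu p {x | K < x.wait ∧ x.right = true} := by
  have := isProbabilityMeasure_expMeasure hlam
  have := isProbabilityMeasure_expMeasure hmu
  have h : {x : Attempt | K < x.wait ∧ x.right = true} =
      Set.Ioi K ×ˢ (({true} : Set Bool) ×ˢ (Set.univ : Set (Bool × ℝ))) := by
    ext x; simp [wait, right]
  rw [h, law, Measure.prod_prod, Measure.prod_prod, measure_univ, mul_one]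
  refine ENNReal.mul_pos (expMeasure_pos_of_lt hlam K).ne' ?_
  classical
  rw [bernoulliMeasure_apply _ (measurableSet_singleton _)]
  have h2 : unitInterval.toNNReal fairCoin ≠ 0 := by
    intro h
    have := congrArg NNReal.toReal h
    simp [fairCoin] at this
  simpa using h2

end Attempt


/-! ### Measurability of the walk -/

lemma measurable_backlog (n : ℕ) :
    Measurable[past Attempt n] fun a : ℕ → Attempt => backlog a n := by
  induction n with
  | zero => exact measurable_const
  | succ n ih =>
    have h1 := ih.mono ((past Attempt).mono n.le_succ) le_rfl
    have h2 := measurable_past_eval (S := Attempt) n.lt_succ_self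
    exact (h1.sub (Attempt.measurable_wait.comp h2)).max (Attempt.measurable_repair.comp h2)

/-- The components of a state, as an element of a measurable space. -/
def State.components (s : State) : ℝ × ℤ × (ℤ → ℝ) := (s.time, s.pos, s.repairedAt)

/-- Joint measurability of evaluation comes from the countability of the index set `ℤ`. -/
lemma measurable_eval_int {α : Type*} [MeasurableSpace α] {f : α → ℤ → ℝ} {z : α → ℤ}
    (hf : Measurable f) (hz : Measurable z) : Measurable fun x => f x (z x) := by
  have h : Measurable fun q : ℤ × (ℤ → ℝ) => q.2 q.1 :=
    measurable_from_prod_countable_right fun z => measurable_pi_apply z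
  exact h.comp (hz.prodMk hf)

lemma measurable_stateAfter (n : ℕ) :
    Measurable fun a : ℕ → Attempt => (stateAfter a n).components := by
  induction n with
  | zero => exact (measurable_const : Measurable fun _ : ℕ → Attempt => State.init.components)
  | succ n ih =>
    have ht : Measurable fun a : ℕ → Attempt => (stateAfter a n).time := measurable_fst.comp ih
    have hp : Measurable fun a : ℕ → Attempt => (stateAfter a n).pos :=
      measurable_fst.comp (measurable_snd.comp ih)
    have hr : Measurable fun a : ℕ → Attempt => (stateAfter a n).repairedAt :=
      measurable_snd.comp (measurable_snd.comp ih)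
    have ha : Measurable fun a : ℕ → Attempt => a n := measurable_pi_apply n
    have htw := ht.add (Attempt.measurable_wait.comp ha)
    have hbr : MeasurableSet {a : ℕ → Attempt | (a n).breaks = true} :=
      (Attempt.measurable_breaks.comp ha) (measurableSet_singleton true)
    have hri : MeasurableSet {a : ℕ → Attempt | (a n).right = true} :=
      (Attempt.measurable_right.comp ha) (measurableSet_singleton true)
    have hl : MeasurableSet {a : ℕ → Attempt | (stateAfter a n).time + (a n).wait <
        (stateAfter a n).repairedAt ((stateAfter a n).pos - 1)} :=
      measurableSet_lt htw (measurable_eval_int hr (hp.sub measurable_const))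
    have hr' : MeasurableSet {a : ℕ → Attempt | (stateAfter a n).time + (a n).wait <
        (stateAfter a n).repairedAt (stateAfter a n).pos} :=
      measurableSet_lt htw (measurable_eval_int hr hp)
    set d : (ℕ → Attempt) → ℤ := fun a => displacement
        ((stateAfter a n).time + (a n).wait <
          (stateAfter a n).repairedAt ((stateAfter a n).pos - 1))
        ((stateAfter a n).time + (a n).wait < (stateAfter a n).repairedAt (stateAfter a n).pos)
        ((a n).right = true) with hd_def
    have hd : Measurable d := by
      simp only [hd_def, displacement]
      exact Measurable.ite (hl.inter hr') measurable_const
        (Measurable.ite hl measurable_const (Measurable.ite hr' measurable_const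
          (Measurable.ite hri measurable_const measurable_const)))
    refine htw.prodMk ((hp.add hd).prodMk (measurable_pi_lambda _ fun e => ?_))
    have hre : Measurable fun a : ℕ → Attempt => (stateAfter a n).repairedAt e :=
      (measurable_pi_apply e).comp hr
    have hd0 : MeasurableSet {a | d a ≠ 0 ∧ (a n).breaks = true} :=
      (hd (measurableSet_singleton 0).compl).inter hbr
    have hd1 : MeasurableSet {a | d a = 1} := hd (measurableSet_singleton 1)
    have hce : MeasurableSet
        {a | (if d a = 1 then (stateAfter a n).pos else (stateAfter a n).pos - 1) = e} :=
      (Measurable.ite hd1 hp (hp.sub_const 1)) (measurableSet_singleton e)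
    have hnew : (fun a => (stateAfter a (n + 1)).repairedAt e) = fun a =>
        if d a ≠ 0 ∧ (a n).breaks = true then
          if (if d a = 1 then (stateAfter a n).pos else (stateAfter a n).pos - 1) = e then
            (stateAfter a n).time + (a n).wait + (a n).repair
          else (stateAfter a n).repairedAt e
        else (stateAfter a n).repairedAt e := by
      funext a
      simp only [hd_def, stateAfter, State.next, apply_ite (fun f : ℤ → ℝ => f e),
        Function.update_apply, eq_comm (a := e)]
    change Measurable fun a => (stateAfter a (n + 1)).repairedAt e
    rw [hnew]
    exact Measurable.ite hd0 (Measurable.ite hce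
      (htw.add (Attempt.measurable_repair.comp ha)) hre) hre

lemma measurable_pos (n : ℕ) : Measurable fun a : ℕ → Attempt => (stateAfter a n).pos :=
  measurable_fst.comp (measurable_snd.comp (measurable_stateAfter n))

/-! ### Drift of the backlog -/

section Law

variable {lam mu : ℝ} {p : unitInterval}

/-- The exponential of the backlog. -/
noncomputable def expBacklog (s : ℝ) (n : ℕ) (a : ℕ → Attempt) : ENNReal :=
  ENNReal.ofReal (Real.exp (s * backlog a n))

lemma measurable_expBacklog (s : ℝ) (n : ℕ) : Measurable[past Attempt n] (expBacklog s n) :=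
  ENNReal.measurable_ofReal.comp (Real.measurable_exp.comp ((measurable_backlog n).const_mul s))

/-- The exponential of a maximum is at most the sum of the exponentials; the first summand factors
into a past term and an independent wait. -/
lemma expBacklog_succ_le (s : ℝ) (n : ℕ) (a : ℕ → Attempt) :
    expBacklog s (n + 1) a ≤ expBacklog s n a * ENNReal.ofReal (Real.exp (-s * (a n).wait)) +
      ENNReal.ofReal (Real.exp (s * (a n).repair)) := by
  simp only [expBacklog, backlog]
  rw [← ENNReal.ofReal_mul (Real.exp_pos _).le, ← ENNReal.ofReal_add (by positivity) (by positivity),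
    ← Real.exp_add]
  apply ENNReal.ofReal_le_ofReal
  rcases max_cases (backlog a n - (a n).wait) (a n).repair with h | h
  · rw [h.1]
    have : s * (backlog a n - (a n).wait) = s * backlog a n + -s * (a n).wait := by ring
    rw [this]
    linarith [Real.exp_pos (s * (a n).repair)]
  · rw [h.1]
    linarith [Real.exp_pos (s * backlog a n + -s * (a n).wait)]

lemma lintegral_exp_wait (hlam : 0 < lam) (hmu : 0 < mu) {s : ℝ} (hs : 0 < s) :
    ∫⁻ x : Attempt, ENNReal.ofReal (Real.exp (-s * x.wait)) ∂(Attempt.law lam mu p) =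
      ENNReal.ofReal (lam / (lam + s)) := by
  rw [(Attempt.measurePreserving_wait hlam hmu).lintegral_comp
    (f := fun x => ENNReal.ofReal (Real.exp (-s * x))) (by fun_prop),
    lintegral_exp_expMeasure hlam (by linarith), sub_neg_eq_add]

lemma lintegral_exp_repair (hlam : 0 < lam) (hmu : 0 < mu) {s : ℝ} (hs : s < mu) :
    ∫⁻ x : Attempt, ENNReal.ofReal (Real.exp (s * x.repair)) ∂(Attempt.law lam mu p) =
      ENNReal.ofReal (mu / (mu - s)) := by
  rw [(Attempt.measurePreserving_repair hlam hmu).lintegral_comp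
    (f := fun x => ENNReal.ofReal (Real.exp (s * x))) (by fun_prop),
    lintegral_exp_expMeasure hmu hs]

/-- One step of the drift estimate, on an event that is known before the step. -/
lemma lintegral_indicator_expBacklog_succ_le (hlam : 0 < lam) (hmu : 0 < mu) {s : ℝ} (hs : 0 < s)
    (hsm : s < mu) {n : ℕ} {G : Set (ℕ → Attempt)} (hG : MeasurableSet[past Attempt n] G) :
    ∫⁻ a in G, expBacklog s (n + 1) a ∂(iidLaw (Attempt.law lam mu p)) ≤
      (∫⁻ a in G, expBacklog s n a ∂(iidLaw (Attempt.law lam mu p))) *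
        ENNReal.ofReal (lam / (lam + s)) +
      iidLaw (Attempt.law lam mu p) G * ENNReal.ofReal (mu / (mu - s)) := by
  have := Attempt.isProbabilityMeasure_law (p := p) hlam hmu
  have hG' := (past Attempt).le n _ hG
  have h1 := lintegral_mul_eval (Attempt.law lam mu p) ((measurable_expBacklog s n).indicator hG)
    (g := fun x => ENNReal.ofReal (Real.exp (-s * x.wait)))
    (ENNReal.measurable_ofReal.comp (Real.measurable_exp.comp
      (Attempt.measurable_wait.const_mul (-s))))
  have h2 := lintegral_mul_eval (Attempt.law lam mu p)
    ((measurable_const (a := (1 : ENNReal))).indicator hG)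
    (g := fun x => ENNReal.ofReal (Real.exp (s * x.repair)))
    (ENNReal.measurable_ofReal.comp (Real.measurable_exp.comp
      (Attempt.measurable_repair.const_mul s)))
  rw [lintegral_exp_wait hlam hmu hs, lintegral_indicator hG'] at h1
  rw [lintegral_exp_repair hlam hmu hsm, lintegral_indicator hG', setLIntegral_one] at h2
  rw [← h1, ← h2, ← lintegral_indicator hG', ← lintegral_add_right]
  · refine lintegral_mono fun a => ?_
    by_cases ha : a ∈ G
    · simpa [ha] using expBacklog_succ_le s n a
    · simp [ha]
  · exact (measurable_const.indicator hG').mul (ENNReal.measurable_ofReal.comp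
      (Real.measurable_exp.comp ((Attempt.measurable_repair.comp
        (measurable_pi_apply n)).const_mul s)))

lemma lintegral_expBacklog_lt_top (hlam : 0 < lam) (hmu : 0 < mu) {s : ℝ} (hs : 0 < s)
    (hsm : s < mu) (n : ℕ) :
    ∫⁻ a, expBacklog s n a ∂(iidLaw (Attempt.law lam mu p)) < ⊤ := by
  have := Attempt.isProbabilityMeasure_law (p := p) hlam hmu
  induction n with
  | zero => simp [expBacklog, backlog]
  | succ n ih =>
    have h := lintegral_indicator_expBacklog_succ_le (p := p) hlam hmu hs hsm
      (n := n) (@MeasurableSet.univ _ (past Attempt n))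
    simp only [Measure.restrict_univ, measure_univ, one_mul] at h
    exact h.trans_lt (ENNReal.add_lt_top.2
      ⟨ENNReal.mul_lt_top ih ENNReal.ofReal_lt_top, ENNReal.ofReal_lt_top⟩)

/-- The backlog is below a fixed level infinitely often. -/
lemma exists_frequently_backlog_le (hlam : 0 < lam) (hmu : 0 < mu) (p : unitInterval) :
    ∃ K : ℝ, ∀ᵐ a ∂(iidLaw (Attempt.law lam mu p)), ∃ᶠ n in atTop, backlog a n ≤ K := by
  have := Attempt.isProbabilityMeasure_law (p := p) hlam hmu
  obtain ⟨s, hs, hsm⟩ : ∃ s, 0 < s ∧ s < mu := exists_between hmu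
  set Q := iidLaw (Attempt.law lam mu p) with hQ
  set θ := lam / (lam + s) with hθ
  set C := mu / (mu - s) with hC
  have hC0 : 0 < C := div_pos hmu (by linarith)
  have hθ0 : 0 < θ := by positivity
  have hθ1 : θ < 1 := by rw [hθ, div_lt_one (by positivity)]; linarith
  -- This makes `ε * C = (1 - θ) / 2`, so the contraction factor `η = θ + ε * C` stays below one.
  set ε := (1 - θ) / (2 * C) with hε
  have hε0 : 0 < ε := by apply div_pos <;> linarith
  set η := ENNReal.ofReal θ + ENNReal.ofReal (ε * C) with hη
  have hη1 : η < 1 := by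
    rw [hη, ← ENNReal.ofReal_add hθ0.le (by positivity), ENNReal.ofReal_lt_one]
    have : ε * C = (1 - θ) / 2 := by rw [hε]; field_simp
    linarith
  -- The solution of `ε * exp (s * K) = 1`: above this level the additive drift term is absorbed
  -- into the exponential.
  set K := -Real.log ε / s with hK
  have hKexp : ∀ x, K < x → 1 ≤ ε * Real.exp (s * x) := by
    intro x hx
    rw [← Real.exp_log hε0, ← Real.exp_add, Real.one_le_exp_iff]
    rw [hK, div_lt_iff₀ hs] at hx
    linarith
  refine ⟨K, ?_⟩
  have key : ∀ m, ∀ᵐ a ∂Q, ∃ n, m ≤ n ∧ backlog a n ≤ K := by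
    intro m
    -- The backlog stays above `K` from index `m` to `m + k`. Its exponential moment on this event
    -- decays like `η ^ k`, and so does the probability of the event.
    let E : ℕ → Set (ℕ → Attempt) := fun k => {a | ∀ j ≤ k, K < backlog a (m + j)}
    have hE : ∀ k, MeasurableSet[past Attempt (m + k)] (E k) := by
      intro k
      have : E k = ⋂ j : ℕ, ⋂ _ : j ≤ k, {a | K < backlog a (m + j)} := by
        ext a; simp [E]
      rw [this]
      refine MeasurableSet.iInter fun j => MeasurableSet.iInter fun hj => ?_
      exact @measurableSet_lt _ _ _ _ _ (past Attempt (m + k)) _ _ _ _ _ measurable_const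
        ((measurable_backlog (m + j)).mono ((past Attempt).mono (by omega)) le_rfl)
    have hE' : ∀ k, MeasurableSet (E k) := fun k => (past Attempt).le _ _ (hE k)
    let u : ℕ → ENNReal := fun k => ∫⁻ a in E k, expBacklog s (m + k) a ∂Q
    have hQE : ∀ k, Q (E k) ≤ ENNReal.ofReal ε * u k := by
      intro k
      rw [← lintegral_const_mul' _ _ ENNReal.ofReal_ne_top, ← setLIntegral_one]
      refine setLIntegral_mono' (hE' k) fun a ha => ?_
      rw [expBacklog, ← ENNReal.ofReal_mul hε0.le, ← ENNReal.ofReal_one]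
      exact ENNReal.ofReal_le_ofReal (hKexp _ (ha k le_rfl))
    have hu : ∀ k, u (k + 1) ≤ u k * η := by
      intro k
      calc u (k + 1) ≤ ∫⁻ a in E k, expBacklog s (m + k + 1) a ∂Q :=
            lintegral_mono_set fun a ha j hj => ha j (by omega)
        _ ≤ u k * ENNReal.ofReal θ + Q (E k) * ENNReal.ofReal C :=
            lintegral_indicator_expBacklog_succ_le hlam hmu hs hsm (hE k)
        _ ≤ u k * ENNReal.ofReal θ + ENNReal.ofReal ε * u k * ENNReal.ofReal C := by
            gcongr; exact hQE k
        _ = u k * η := by rw [hη, ENNReal.ofReal_mul hε0.le]; ring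
    have hu' : ∀ k, u k ≤ u 0 * η ^ k := by
      intro k
      induction k with
      | zero => simp
      | succ k ih =>
        calc u (k + 1) ≤ u k * η := hu k
          _ ≤ u 0 * η ^ k * η := by gcongr
          _ = u 0 * η ^ (k + 1) := by ring
    have hu0 : u 0 ≠ ⊤ := ((setLIntegral_le_lintegral _ _).trans_lt
      (lintegral_expBacklog_lt_top hlam hmu hs hsm (m + 0))).ne
    have hlim : Tendsto (fun k => ENNReal.ofReal ε * (u 0 * η ^ k)) atTop (nhds 0) := by
      have h1 := ENNReal.tendsto_pow_atTop_nhds_zero_of_lt_one hη1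
      have h2 := ENNReal.Tendsto.const_mul h1 (Or.inr hu0)
      have h3 := ENNReal.Tendsto.const_mul h2 (Or.inr (ENNReal.ofReal_ne_top (r := ε)))
      simpa using h3
    rw [ae_iff]
    refine le_antisymm (ge_of_tendsto' hlim fun k => ?_) zero_le
    refine (measure_mono fun a ha => ?_).trans ((hQE k).trans (by gcongr; exact hu' k))
    intro j _
    by_contra hj
    exact ha ⟨m + j, by omega, not_lt.1 hj⟩
  filter_upwards [ae_all_iff.2 key] with a ha
  exact frequently_atTop.2 fun m => ha m

lemma ae_wait_pos (hlam : 0 < lam) (hmu : 0 < mu) (p : unitInterval) :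
    ∀ᵐ a ∂(iidLaw (Attempt.law lam mu p)), ∀ n, 0 < (a n).wait := by
  have := Attempt.isProbabilityMeasure_law (p := p) hlam hmu
  refine ae_all_iff.2 fun n => ?_
  have h1 := (Attempt.measurePreserving_wait (p := p) hlam hmu).quasiMeasurePreserving.ae
    (ae_expMeasure_pos hlam)
  exact (measurePreserving_eval_infinitePi (fun _ : ℕ => Attempt.law lam mu p)
    n).quasiMeasurePreserving.ae h1

lemma ae_frequently_one_le_wait (hlam : 0 < lam) (hmu : 0 < mu) (p : unitInterval) :
    ∀ᵐ a ∂(iidLaw (Attempt.law lam mu p)), ∀ m, ∃ n, m ≤ n ∧ 1 ≤ (a n).wait := by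
  have := Attempt.isProbabilityMeasure_law (p := p) hlam hmu
  refine ae_all_iff.2 fun m => ?_
  have hmeas : ∀ n, MeasurableSet {a : ℕ → Attempt | (a n).wait < 1} := fun n =>
    measurableSet_lt (Attempt.measurable_wait.comp (measurable_pi_apply n)) measurable_const
  set q := Attempt.law lam mu p {x | x.wait < 1} with hq
  have hm1 : MeasurableSet {x : Attempt | x.wait < 1} :=
    measurableSet_lt Attempt.measurable_wait measurable_const
  have hq1 : q < 1 := by
    refine lt_of_le_of_ne prob_le_one fun h => ?_
    have h0 := (prob_compl_eq_zero_iff hm1).2 h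
    have := Attempt.law_pos (p := p) hlam hmu 1
    refine this.ne' (measure_mono_null (fun x hx => ?_) h0)
    simp only [Set.mem_compl_iff, Set.mem_ofPred_eq, not_lt] at hx ⊢
    exact hx.1.le
  rw [ae_iff]
  refine le_antisymm (ge_of_tendsto' (ENNReal.tendsto_pow_atTop_nhds_zero_of_lt_one hq1)
    fun k => ?_) zero_le
  have hbox := Measure.infinitePi_pi (fun _ : ℕ => Attempt.law lam mu p)
    (s := Finset.Ico m (m + k)) (t := fun _ => {x | x.wait < 1}) (fun _ _ => hm1)
  rw [Finset.prod_const, Nat.card_Ico, Nat.add_sub_cancel_left] at hbox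
  rw [← hbox]
  refine measure_mono fun a ha i hi => ?_
  by_contra hlt
  exact ha ⟨i, (Finset.mem_Ico.1 hi).1, not_lt.1 hlt⟩

/-! ### Almost sure unboundedness in both directions -/

/-- An event is almost sure if it occurs as soon as the attempts that follow a time at which all
bonds are intact belong to a set of positive measure. -/
lemma ae_mem_of_restart (hlam : 0 < lam) (hmu : 0 < mu) {K : ℝ}
    (hK : ∀ᵐ a ∂(iidLaw (Attempt.law lam mu p)), ∃ᶠ n in atTop, backlog a n ≤ K)
    {A E : Set (ℕ → Attempt)} (hA : MeasurableSet A) (hE : MeasurableSet E)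
    (hA0 : iidLaw (Attempt.law lam mu p) A ≠ 0) (hAK : ∀ a ∈ A, K < (a 0).wait)
    (h : ∀ a : ℕ → Attempt, (∀ n, 0 < (a n).wait) → ∀ n, backlog a n ≤ (a n).wait →
      (fun i => a (n + i)) ∈ A → a ∈ E) :
    ∀ᵐ a ∂(iidLaw (Attempt.law lam mu p)), a ∈ E := by
  have := Attempt.isProbabilityMeasure_law (p := p) hlam hmu
  refine ae_mem_of_frequently_le _ (past Attempt) iSup_past hE (B := fun n => {a | backlog a n ≤ K})
    (fun n => @measurableSet_le _ _ _ _ _ (past Attempt n) _ _ _ _ _ (measurable_backlog n)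
      measurable_const) hK
    (ENNReal.toReal_pos hA0 (measure_ne_top _ _)) ?_
  intro n G hG hGB
  -- By independence, the measure of `A` times that of `G` is the probability of `G` followed by a
  -- shifted sequence in `A`; this event lies in `E` up to a null set.
  rw [← measureReal_def, measureReal_def, measureReal_def, mul_comm, ← ENNReal.toReal_mul,
    ← measure_inter_shift _ hG hA, measureReal_def]
  refine ENNReal.toReal_mono (measure_ne_top _ _) (measure_mono_ae ?_)
  filter_upwards [ae_wait_pos hlam hmu p] with a ha haG
  refine ⟨haG.1, h a ha n ?_ haG.2⟩
  have := hAK _ haG.2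
  exact (hGB haG.1).trans this.le

/-- The event that the walk is unbounded above. -/
def Above : Set (ℕ → Attempt) := {a | ∀ M : ℕ, ∃ n, (M : ℤ) ≤ (stateAfter a n).pos}

/-- The event that the walk is unbounded below. -/
def Below : Set (ℕ → Attempt) := {a | ∀ M : ℕ, ∃ n, (stateAfter a n).pos ≤ -(M : ℤ)}

lemma measurableSet_Above : MeasurableSet Above := by
  have : Above = ⋂ M : ℕ, ⋃ n, {a | (M : ℤ) ≤ (stateAfter a n).pos} := by
    ext a; simp [Above]
  rw [this]
  exact MeasurableSet.iInter fun M => MeasurableSet.iUnion fun n =>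
    measurableSet_le measurable_const (measurable_pos n)

lemma reflect_mem_Above (a : ℕ → Attempt) : (fun i => (a i).reflect) ∈ Above ↔ a ∈ Below := by
  simp only [Above, Below, Set.mem_ofPred_eq, (stateAfter_reflect a _).2.1, le_neg]

lemma measurePreserving_reflect_iid (hlam : 0 < lam) (hmu : 0 < mu) :
    MeasurePreserving (fun (a : ℕ → Attempt) i => (a i).reflect)
      (iidLaw (Attempt.law lam mu p)) (iidLaw (Attempt.law lam mu p)) := by
  have := Attempt.isProbabilityMeasure_law (p := p) hlam hmu
  refine ⟨measurable_pi_lambda _ fun i => Attempt.measurable_reflect.comp (measurable_pi_apply i),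
    ?_⟩
  rw [Measure.infinitePi_map_pi _ fun _ => Attempt.measurable_reflect]
  simp only [(Attempt.measurePreserving_reflect hlam hmu).map_eq]

/-- A walk confined strictly between `-M₂` and `M₁` has no displacement of `M₁ + M₂ + 1`, yet a run
of that many right moves after a restart almost surely occurs. -/
lemma ae_mem_Above_or_Below (hlam : 0 < lam) (hmu : 0 < mu) :
    ∀ᵐ a ∂(iidLaw (Attempt.law lam mu p)), a ∈ Above ∨ a ∈ Below := by
  have := Attempt.isProbabilityMeasure_law (p := p) hlam hmu
  obtain ⟨K, hK⟩ := exists_frequently_backlog_le hlam hmu p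
  have h : ∀ M : ℕ, ∀ᵐ a ∂(iidLaw (Attempt.law lam mu p)), a ∈ {a | ∃ n,
      (stateAfter a (n + (M + 1))).pos = ((M + 1 : ℕ) : ℤ) + (stateAfter a n).pos} := by
    intro M
    have hm : MeasurableSet {x : Attempt | max K 0 < x.wait ∧ x.right = true} :=
      (measurableSet_lt measurable_const Attempt.measurable_wait).inter
        (Attempt.measurable_right (measurableSet_singleton true))
    refine ae_mem_of_restart hlam hmu hK
      (A := ((Finset.range (M + 1) : Finset ℕ) : Set ℕ).pi
        fun _ => {x | max K 0 < x.wait ∧ x.right = true})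
      (MeasurableSet.pi (Finset.countable_toSet _) fun _ _ => hm) ?_ ?_ ?_ ?_
    · have : {a : ℕ → Attempt | ∃ n, (stateAfter a (n + (M + 1))).pos =
          ((M + 1 : ℕ) : ℤ) + (stateAfter a n).pos} = ⋃ n, {a : ℕ → Attempt |
          (stateAfter a (n + (M + 1))).pos = ((M + 1 : ℕ) : ℤ) + (stateAfter a n).pos} := by
        ext a; simp
      rw [this]
      exact MeasurableSet.iUnion fun n =>
        measurableSet_eq_fun (measurable_pos _) ((measurable_pos n).const_add _)
    · rw [Measure.infinitePi_pi _ fun _ _ => hm, Finset.prod_const]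
      exact pow_ne_zero _ (Attempt.law_pos hlam hmu _).ne'
    · intro a ha
      exact (le_max_left _ _).trans_lt (ha 0 (by simp)).1
    · intro a ha n hn hs
      refine ⟨n, ?_⟩
      rw [pos_add_of_backlog_le a (fun i => (ha i).le) n hn, pos_of_forall_right]
      intro i hi
      have := hs i (by simpa using hi)
      exact ⟨(ha _).le, this.2⟩
  filter_upwards [ae_all_iff.2 h] with a ha
  by_contra hcon
  simp only [Above, Below, Set.mem_ofPred_eq, not_or, not_forall, not_exists, not_le] at hcon
  obtain ⟨⟨M₁, h₁⟩, M₂, h₂⟩ := hcon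
  obtain ⟨n, hn⟩ := ha (M₁ + M₂)
  have := h₁ (n + (M₁ + M₂ + 1))
  have := h₂ n
  push_cast at hn
  omega

/-- `W` is invariant under reflection. If `W ∩ Above` were null, so would be `W ∩ Below`, and hence
`W`, which has positive measure. -/
lemma ae_mem_Above (hlam : 0 < lam) (hmu : 0 < mu) :
    ∀ᵐ a ∂(iidLaw (Attempt.law lam mu p)), a ∈ Above := by
  have := Attempt.isProbabilityMeasure_law (p := p) hlam hmu
  obtain ⟨K, hK⟩ := exists_frequently_backlog_le hlam hmu p
  have hm0 : MeasurableSet {x : Attempt | K < x.wait} :=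
    measurableSet_lt measurable_const Attempt.measurable_wait
  set W : Set (ℕ → Attempt) := {a | K < (a 0).wait} with hW
  have hWm : MeasurableSet W := (measurable_pi_apply (X := fun _ : ℕ => Attempt) 0) hm0
  refine ae_mem_of_restart hlam hmu hK (A := W ∩ Above) (hWm.inter measurableSet_Above)
    measurableSet_Above ?_ (fun a ha => ha.1) ?_
  · intro h0
    have hrefl := (measurePreserving_reflect_iid (p := p) hlam hmu).measure_preimage
      (hWm.inter measurableSet_Above).nullMeasurableSet
    have hpre : (fun (a : ℕ → Attempt) i => (a i).reflect) ⁻¹' (W ∩ Above) = W ∩ Below := by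
      ext a
      exact and_congr Iff.rfl (reflect_mem_Above a)
    rw [hpre, h0] at hrefl
    have hW0 : iidLaw (Attempt.law lam mu p) W = 0 := by
      have h2 := measure_union_null h0 hrefl
      rw [← nonpos_iff_eq_zero, ← h2]
      refine measure_mono_ae ?_
      filter_upwards [ae_mem_Above_or_Below hlam hmu] with a ha haW
      exact ha.imp (fun h => ⟨haW, h⟩) fun h => ⟨haW, h⟩
    have h3 := (measurePreserving_eval_infinitePi (fun _ : ℕ => Attempt.law lam mu p)
      0).measure_preimage hm0.nullMeasurableSet
    refine (Attempt.law_pos (p := p) hlam hmu K).ne' (measure_mono_null (fun x hx => hx.1) ?_)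
    exact h3.symm.trans hW0
  · intro a ha n hn hs M
    -- The extra height compensates for a possibly negative position at the restart.
    obtain ⟨k, hk⟩ := hs.2 (M + (stateAfter a n).pos.natAbs)
    refine ⟨n + k, ?_⟩
    rw [pos_add_of_backlog_le a (fun i => (ha i).le) n hn]
    have := neg_abs_le (stateAfter a n).pos
    push_cast at hk
    omega

lemma ae_mem_Below (hlam : 0 < lam) (hmu : 0 < mu) :
    ∀ᵐ a ∂(iidLaw (Attempt.law lam mu p)), a ∈ Below := by
  filter_upwards [(measurePreserving_reflect_iid (p := p) hlam hmu).quasiMeasurePreserving.ae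
    (ae_mem_Above hlam hmu)] with a ha
  exact (reflect_mem_Above a).1 ha

end Law

end CollapsingBonds

theorem theorem1 {Ω : Type*} [MeasurableSpace Ω] (P : Measure Ω) [IsProbabilityMeasure P]
    (lam mu : ℝ) (hlam : 0 < lam) (hmu : 0 < mu) (p : unitInterval) (hp : 0 < p)
    (a : ℕ → Ω → CollapsingBonds.Attempt)
    (hlaw : ∀ n, HasLaw (a n) (CollapsingBonds.Attempt.law lam mu p) P)
    (hindep : iIndepFun a P) :
    CollapsingBonds.IsRecurrent
      (fun t ω => CollapsingBonds.position (fun n => a n ω) t) P := by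
  have hm : AEMeasurable (fun ω n => a n ω) P := aemeasurable_pi_iff.2 fun n => (hlaw n).aemeasurable
  have hseq := hindep.hasLaw_infinitePi hlaw hm
  -- The claim depends only on the joint law of the sequence, which is the product law.
  have h : ∀ᵐ b ∂(P.map fun ω n => a n ω), ∀ x : ℤ, ∀ s : ℝ, ∃ t : ℝ,
      s ≤ t ∧ CollapsingBonds.position b t = x := by
    rw [hseq.map_eq]
    filter_upwards [CollapsingBonds.ae_wait_pos hlam hmu p,
      CollapsingBonds.ae_frequently_one_le_wait hlam hmu p,
      CollapsingBonds.ae_mem_Above hlam hmu, CollapsingBonds.ae_mem_Below hlam hmu]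
      with b h1 h2 h3 h4
    exact CollapsingBonds.exists_time_position_eq h1 h2 h3 h4
  exact ae_of_ae_map hm h
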